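/- Let $M$ be a simple matroid of rank $r$ on the ground set $[n]$ (simple: no loops, and every two distinct elements form a set of rank $2$), and let $g_M(z_1,\dots,z_n)=\sum_{B}\prod_{i\in B}z_i$ be its basis generating polynomial, the sum being over the bases $B$ of $M$. For $v\in\mathbb{R}^n$ write $\partial_v=\sum_{i=1}^n v_i\,\partial_{z_i}$, and for $V\in\mathbb{R}^{n\times k}$ put $D_V=\prod_{j=1}^k\sum_{i=1}^n V_{ij}\,\partial_{z_i}$ (the identity if $k=0$). Let $0\le k\le r-2$, let $V\in\mathbb{R}_{\ge 0}^{n\times k}$ be a matrix with nonnegative entries, let $\lambda\in\mathbb{R}_{\ge 0}^n$, and consider the bilinear form on $\mathbb{R}^n$ $$q_{V,\lambda}(a,b)=\partial_a\partial_b D_V g_M(z)\big|_{z=\lambda}.$$ Then: 1. $q_{V,\lambda}$ is symmetric. 2. If $\lambda\in\mathbb{R}_{>0}^n$ or the linear functional $q_{V,\lambda}(\lambda,\cdot)$ is not identically zero, then $q_{V,\lambda}$ is negative semidefinite on the kernel of $q_{V,\lambda}(\lambda,\cdot)$; that is, $q_{V,\lambda}(a,a)\le 0$ for every $a\in\mathbb{R}^n$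 with $q_{V,\lambda}(\lambda,a)=0$. 3. For every $\lambda\in\mathbb{R}_{\ge 0}^n$, the Hessian matrix of $D_V g_M$ at $z=\lambda$ (a real symmetric matrix) has at most one positive eigenvalue, counted with multiplicity. -/

import Mathlib

open MvPolynomial

noncomputable section

/-- A matroid is simple if it has no loops and no parallel elements: any two distinct elements
of the ground set span a set of rank `2`. -/
def Matroid.IsSimple {α : Type*} (M : Matroid α) : Prop :=
  M.Loopless ∧ ∀ i ∈ M.E, ∀ j ∈ M.E, i ≠ j → M.eRk {i, j} = 2

open Classical in
/-- The basis generating polynomial `g_M(z₁, …, zₙ) = ∑_B ∏_{i ∈ B} zᵢ`, where `B` ranges over the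
bases of `M`. -/
def Matroid.basisGenPoly {n : ℕ} (M : Matroid (Fin n)) : MvPolynomial (Fin n) ℝ :=
  ∑ B : Finset (Fin n) with M.IsBase (B : Set (Fin n)), ∏ i ∈ B, X i

/-- The directional derivative `∂_v = ∑ᵢ vᵢ ∂ᵢ` as a linear operator on `ℝ[z₁, …, zₙ]`. -/
def dirDeriv {n : ℕ} (v : Fin n → ℝ) : Module.End ℝ (MvPolynomial (Fin n) ℝ) :=
  ∑ i, v i • (pderiv i : Derivation ℝ (MvPolynomial (Fin n) ℝ) (MvPolynomial (Fin n) ℝ)).toLinearMap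

/-- The operator `D_V = ∏ⱼ (∑ᵢ Vᵢⱼ ∂ᵢ)`: the composition of the directional derivatives along the
columns of `V` (the identity if `V` has no columns). -/
def matDeriv {n k : ℕ} (V : Matrix (Fin n) (Fin k) ℝ) : Module.End ℝ (MvPolynomial (Fin n) ℝ) :=
  (List.ofFn fun j : Fin k => dirDeriv fun i => V i j).prod

theorem dirDeriv_add {n : ℕ} (v w : Fin n → ℝ) : dirDeriv (v + w) = dirDeriv v + dirDeriv w := by
  simp [dirDeriv, add_smul, Finset.sum_add_distrib]

theorem dirDeriv_smul {n : ℕ} (c : ℝ) (v : Fin n → ℝ) : dirDeriv (c • v) = c • dirDeriv v := by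
  simp [dirDeriv, Finset.smul_sum, mul_smul]

/-- The bilinear form `(a, b) ↦ ∂_a ∂_b p (x)` on `ℝⁿ`. -/
def secondDerivForm {n : ℕ} (p : MvPolynomial (Fin n) ℝ) (x : Fin n → ℝ) :
    LinearMap.BilinForm ℝ (Fin n → ℝ) :=
  LinearMap.mk₂ ℝ (fun a b => eval x (dirDeriv a (dirDeriv b p)))
    (fun a a' b => by simp [dirDeriv_add])
    (fun c a b => by simp [dirDeriv_smul, smul_eval])
    (fun a b b' => by simp [dirDeriv_add])
    (fun c a b => by simp [dirDeriv_smul, smul_eval])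

/-- The Hessian matrix `(∂ᵢ ∂ⱼ p (x))ᵢⱼ`. -/
def hessianAt {n : ℕ} (p : MvPolynomial (Fin n) ℝ) (x : Fin n → ℝ) :
    Matrix (Fin n) (Fin n) ℝ :=
  Matrix.of fun i j => eval x (pderiv i (pderiv j p))

/-- A real square matrix is symmetric and at most one of its eigenvalues, counted with
multiplicity, is positive. -/
def IsSymmWithAtMostOnePosEigenvalue {n : ℕ} (A : Matrix (Fin n) (Fin n) ℝ) : Prop :=
  ∃ hA : A.IsHermitian, {i | 0 < hA.eigenvalues i}.ncard ≤ 1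

end

/-! Everything is reduced to the reversed Cauchy–Schwarz inequality for the Hessian. Differentiating
`basisGenPoly` at a nonloop `e` gives the polynomial of `M ／ {e}`, so the Hessian after one more
derivative along a positive `v` is a `v`-weighted sum of Hessians attached to contractions. In rank
2 the Hessian is a rank-one square minus a sum of squares over parallel classes. The step up in rank
is the Bochner-type argument `ReversedCauchySchwarz.of_slices`; the connectivity it needs holds
because two nonloops in rank at least 3 have a common independent partner. By homogeneity,
evaluating at a positive point amounts to differentiating further along that point, and nonnegative
data are limits of positive data. The three claims then follow by linear algebra and nonnegativity
of the Hessian entries. -/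

/-- A real matrix `A` satisfies the reversed Cauchy–Schwarz inequality if
`(aᵀAa)(bᵀAb) ≤ (aᵀAb)²` whenever `aᵀAa > 0`. For symmetric `A` this means that `A` has at most one
positive eigenvalue. -/
def Matrix.ReversedCauchySchwarz {ι : Type*} [Fintype ι] (A : Matrix ι ι ℝ) : Prop :=
  ∀ a b : ι → ℝ, 0 < a ⬝ᵥ A.mulVec a →
    (a ⬝ᵥ A.mulVec a) * (b ⬝ᵥ A.mulVec b) ≤ (a ⬝ᵥ A.mulVec b) ^ 2

/-! ### Reversed Cauchy–Schwarz and spectra of symmetric matrices -/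

namespace Matrix

variable {ι : Type*} [Fintype ι]

theorem IsSymm.dotProduct_mulVec_comm {A : Matrix ι ι ℝ} (hA : A.IsSymm) (a b : ι → ℝ) :
    a ⬝ᵥ A.mulVec b = b ⬝ᵥ A.mulVec a := by
  rw [dotProduct_mulVec, ← mulVec_transpose, hA.eq, dotProduct_comm]

theorem reversedCauchySchwarz_zero : (0 : Matrix ι ι ℝ).ReversedCauchySchwarz := by
  intro a b h
  simp at h

theorem ReversedCauchySchwarz.of_nonpos_on_ker {A : Matrix ι ι ℝ} (hA : A.IsSymm) (w : ι → ℝ)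
    (h : ∀ x, w ⬝ᵥ x = 0 → x ⬝ᵥ A.mulVec x ≤ 0) : A.ReversedCauchySchwarz := by
  intro a b ha
  have hs : w ⬝ᵥ a ≠ 0 := fun h0 => (h a h0).not_gt ha
  -- This combination lies in the hyperplane. Multiplying its inequality by `p > 0` and completing
  -- the square gives `s²(pq - m²) + (sm - tp)² ≤ 0`.
  have hc := h ((w ⬝ᵥ a) • b - (w ⬝ᵥ b) • a) (by
    simp only [dotProduct_sub, dotProduct_smul, smul_eq_mul]; ring)
  simp only [mulVec_sub, mulVec_smul, dotProduct_sub, sub_dotProduct, dotProduct_smul,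
    smul_dotProduct, smul_eq_mul, hA.dotProduct_mulVec_comm b a] at hc
  set s := w ⬝ᵥ a
  set t := w ⬝ᵥ b
  set p := a ⬝ᵥ A.mulVec a
  set q := b ⬝ᵥ A.mulVec b
  set m := a ⬝ᵥ A.mulVec b
  have hs2 : 0 < s ^ 2 := by positivity
  have key : s ^ 2 * (p * q - m ^ 2) ≤ 0 := by
    have := mul_nonpos_of_nonneg_of_nonpos ha.le hc
    nlinarith [sq_nonneg (s * m - t * p)]
  nlinarith [nonpos_of_mul_nonpos_right key hs2]

theorem ReversedCauchySchwarz.of_smul {A : Matrix ι ι ℝ} {c : ℝ} (hc : 0 < c)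
    (h : (c • A).ReversedCauchySchwarz) : A.ReversedCauchySchwarz := by
  intro a b ha
  have := h a b (by simpa [smul_mulVec] using mul_pos hc ha)
  simp only [smul_mulVec, dotProduct_smul, smul_eq_mul] at this
  have h2 : 0 < c ^ 2 := by positivity
  refine le_of_mul_le_mul_left ?_ h2
  linarith

/-- The premise is a strict inequality, so it holds along the family near the limit, and the
conclusion is closed. -/
theorem ReversedCauchySchwarz.of_tendsto {α : Type*} {l : Filter α} [l.NeBot]
    {A : α → Matrix ι ι ℝ} {B : Matrix ι ι ℝ}
    (hAB : ∀ i j, Filter.Tendsto (fun t => A t i j) l (nhds (B i j)))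
    (hA : ∀ᶠ t in l, (A t).ReversedCauchySchwarz) : B.ReversedCauchySchwarz := by
  have hlim : ∀ a b : ι → ℝ,
      Filter.Tendsto (fun t => a ⬝ᵥ (A t).mulVec b) l (nhds (a ⬝ᵥ B.mulVec b)) := by
    intro a b
    simp only [dotProduct, mulVec]
    exact tendsto_finsetSum _ fun i _ => tendsto_const_nhds.mul <|
      tendsto_finsetSum _ fun j _ => (hAB i j).mul tendsto_const_nhds
  intro a b ha
  refine le_of_tendsto_of_tendsto ((hlim a a).mul (hlim b b)) ((hlim a b).pow 2) ?_
  filter_upwards [hA, (hlim a a).eventually (lt_mem_nhds ha)] with t ht hpos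
  exact ht a b hpos

/-- A symmetric matrix is nonpositive at every vector orthogonal to all eigenvectors with positive
eigenvalue. -/
theorem IsSymm.dotProduct_mulVec_nonpos {C : Matrix ι ι ℝ} (hC : C.IsSymm) (y : ι → ℝ)
    (h : ∀ (μ : ℝ) (e : ι → ℝ), 0 < μ → C.mulVec e = μ • e → e ⬝ᵥ y = 0) :
    y ⬝ᵥ C.mulVec y ≤ 0 := by
  classical
  have hH : C.IsHermitian := by rw [IsHermitian, conjTranspose_eq_transpose_of_trivial, hC.eq]
  have hsum := hH.eigenvectorBasis.sum_inner_mul_inner (WithLp.toLp 2 y)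
    (WithLp.toLp 2 (C.mulVec y))
  simp only [EuclideanSpace.inner_eq_star_dotProduct, star_trivial] at hsum
  rw [dotProduct_comm, ← hsum]
  refine Finset.sum_nonpos fun k _ => ?_
  have hk := hH.mulVec_eigenvectorBasis k
  set e : ι → ℝ := (hH.eigenvectorBasis k).ofLp
  have h1 : C.mulVec y ⬝ᵥ e = hH.eigenvalues k * (e ⬝ᵥ y) := by
    rw [dotProduct_comm, hC.dotProduct_mulVec_comm, hk, dotProduct_smul, dotProduct_comm,
      smul_eq_mul]
  rw [h1]
  rcases le_or_gt (hH.eigenvalues k) 0 with hle | hpos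
  · nlinarith [mul_nonneg (neg_nonneg.2 hle) (sq_nonneg (e ⬝ᵥ y))]
  · rw [h _ e hpos hk, zero_mul]

/-- A symmetric matrix satisfying the reversed Cauchy–Schwarz inequality has at most one positive
eigenvalue. -/
theorem ReversedCauchySchwarz.ncard_pos_eigenvalues_le_one [DecidableEq ι] {A : Matrix ι ι ℝ}
    (h : A.ReversedCauchySchwarz) (hA : A.IsHermitian) :
    {i | 0 < hA.eigenvalues i}.ncard ≤ 1 := by
  rw [Set.ncard_le_one]
  have hq : ∀ i j, (hA.eigenvectorBasis i).ofLp ⬝ᵥ A.mulVec (hA.eigenvectorBasis j).ofLp =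
      hA.eigenvalues j * if i = j then 1 else 0 := by
    intro i j
    have ho := orthonormal_iff_ite.1 hA.eigenvectorBasis.orthonormal i j
    rw [EuclideanSpace.inner_eq_star_dotProduct, star_trivial] at ho
    rw [hA.mulVec_eigenvectorBasis, dotProduct_smul, dotProduct_comm, ho, smul_eq_mul]
  intro i hi j hj
  by_contra hij
  have := h (hA.eigenvectorBasis i).ofLp (hA.eigenvectorBasis j).ofLp
  simp only [hq, hij, if_true, if_false, mul_one, mul_zero] at this
  have h2 := this hi
  have h3 : 0 < hA.eigenvalues i * hA.eigenvalues j := mul_pos hi hj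
  linarith

end Matrix

/-! ### Local-to-global principle -/

namespace Matrix

variable {ι : Type*} [Fintype ι]

/-- Local-to-global principle: let `T` be a symmetric nonnegative 3-tensor all of whose slices
satisfy the reversed Cauchy–Schwarz inequality. Then so does the contraction `A` of `T` with a
positive vector, provided that `A` is sufficiently connected on its nonzero rows. -/
theorem ReversedCauchySchwarz.of_slices {T : ι → Matrix ι ι ℝ} {A : Matrix ι ι ℝ} {v : ι → ℝ}
    (hA : ∀ i j, A i j = ∑ l, v l * T l i j) (hv : ∀ i, 0 < v i)
    (hT0 : ∀ l i j, 0 ≤ T l i j) (hT1 : ∀ l i j, T l i j = T l j i)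
    (hT2 : ∀ l i j, T l i j = T i l j) (hT : ∀ l, (T l).ReversedCauchySchwarz)
    (hconn : ∀ i j, T i ≠ 0 → T j ≠ 0 → ∃ k, 0 < A i k ∧ 0 < A j k) :
    A.ReversedCauchySchwarz := by
  have hA0 : ∀ i j, 0 ≤ A i j := fun i j => by
    rw [hA]; exact Finset.sum_nonneg fun l _ => mul_nonneg (hv l).le (hT0 l i j)
  have hAs : ∀ i j, A i j = A j i := fun i j => by simp only [hA, hT1 _ i j]
  have hAsymm : A.IsSymm := by ext i j; exact hAs j i
  have hAx : ∀ x i, A.mulVec x i = v ⬝ᵥ (T i).mulVec x := by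
    intro x i
    simp only [mulVec, dotProduct, hA, Finset.sum_mul, Finset.mul_sum]
    rw [Finset.sum_comm]
    refine Finset.sum_congr rfl fun l _ => Finset.sum_congr rfl fun j _ => ?_
    rw [hT2 l i j]; ring
  have hxAx : ∀ x : ι → ℝ, x ⬝ᵥ A.mulVec x = ∑ l, v l * (x ⬝ᵥ (T l).mulVec x) := by
    intro x
    simp only [mulVec, dotProduct, hA, Finset.sum_mul, Finset.mul_sum]
    rw [Finset.sum_congr rfl fun i _ => Finset.sum_comm, Finset.sum_comm]
    refine Finset.sum_congr rfl fun l _ => Finset.sum_congr rfl fun i _ =>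
      Finset.sum_congr rfl fun j _ => ?_
    ring
  set w := A.mulVec v with hw
  have hw0 : ∀ i, 0 ≤ w i := fun i =>
    Finset.sum_nonneg fun j _ => mul_nonneg (hA0 i j) (hv j).le
  have hwT : ∀ i, w i = 0 → T i = 0 := by
    intro i hi
    rw [hw, hAx] at hi
    have h1 : ∀ l j, 0 ≤ T i l j * v j := fun l j => mul_nonneg (hT0 i l j) (hv j).le
    have h2 : ∀ l, 0 ≤ v l * (T i).mulVec v l := fun l =>
      mul_nonneg (hv l).le (Finset.sum_nonneg fun j _ => h1 l j)
    ext l j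
    have h3 := (Finset.sum_eq_zero_iff_of_nonneg fun l _ => h2 l).1 hi l (Finset.mem_univ l)
    have h4 : (T i).mulVec v l = 0 := (mul_eq_zero.1 h3).resolve_left (hv l).ne'
    have h5 := (Finset.sum_eq_zero_iff_of_nonneg fun j _ => h1 l j).1 h4 j (Finset.mem_univ j)
    exact (mul_eq_zero.1 h5).resolve_right (hv j).ne'
  have hwA : ∀ i, w i = 0 → ∀ j, A i j = 0 := by
    intro i hi j
    rw [hA]
    refine Finset.sum_eq_zero fun l _ => ?_
    rw [hT2, hwT i hi]; simp
  -- Reversed Cauchy–Schwarz in the slice `T i` for `v` and `x`, where `v ⬝ᵥ (T i).mulVec v = w i`,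
  -- weighted by `v i / w i` and summed.
  have hbochner : ∀ x : ι → ℝ, x ⬝ᵥ A.mulVec x ≤ ∑ i, v i / w i * (A.mulVec x i) ^ 2 := by
    intro x
    rw [hxAx]
    refine Finset.sum_le_sum fun i _ => ?_
    rcases (hw0 i).eq_or_lt with hi | hi
    · rw [hwT i hi.symm, ← hi]; simp
    · have h1 : 0 < v ⬝ᵥ (T i).mulVec v := by rwa [← hAx]
      have h2 := hT i v x h1
      rw [← hAx, ← hAx] at h2
      rw [div_mul_eq_mul_div, le_div_iff₀ hi]
      change w i * _ ≤ _ at h2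
      nlinarith [mul_le_mul_of_nonneg_left h2 (hv i).le]
  -- The Dirichlet energy of `x / v` on the graph with weights `A i j * v i * v j`; its
  -- nonnegativity will bound eigenvalues by 1.
  have hlap : ∀ x : ι → ℝ, ∑ i, ∑ j, A i j * v i * v j * (x i / v i - x j / v j) ^ 2 =
      2 * (∑ i, w i * x i ^ 2 / v i - x ⬝ᵥ A.mulVec x) := by
    intro x
    have h1 : ∑ i, w i * x i ^ 2 / v i = ∑ i, ∑ j, A i j * v j * x i ^ 2 / v i := by
      refine Finset.sum_congr rfl fun i _ => ?_
      simp only [hw, mulVec, dotProduct, Finset.sum_mul, Finset.sum_div]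
    have h2 : ∑ i, w i * x i ^ 2 / v i = ∑ i, ∑ j, A i j * v i * x j ^ 2 / v j := by
      rw [h1, Finset.sum_comm]
      refine Finset.sum_congr rfl fun i _ => Finset.sum_congr rfl fun j _ => ?_
      rw [hAs]
    have h3 : x ⬝ᵥ A.mulVec x = ∑ i, ∑ j, A i j * x i * x j := by
      simp only [mulVec, dotProduct, Finset.mul_sum]
      refine Finset.sum_congr rfl fun i _ => Finset.sum_congr rfl fun j _ => ?_
      ring
    rw [mul_sub, two_mul, h3]
    nth_rw 1 [h1]
    rw [h2, Finset.mul_sum, ← Finset.sum_add_distrib, ← Finset.sum_sub_distrib]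
    refine Finset.sum_congr rfl fun i _ => ?_
    rw [Finset.mul_sum, ← Finset.sum_add_distrib, ← Finset.sum_sub_distrib]
    refine Finset.sum_congr rfl fun j _ => ?_
    have := (hv i).ne'
    have := (hv j).ne'
    field_simp
    ring
  -- The scaling makes `v / s` an eigenvector of `C` with eigenvalue 1. Where `w i = 0`, division by
  -- zero gives `s i = 0`, which is harmless because that row of `A` vanishes.
  set s : ι → ℝ := fun i => √(v i / w i) with hs
  have hs2 : ∀ i, s i ^ 2 = v i / w i := fun i => Real.sq_sqrt (div_nonneg (hv i).le (hw0 i))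
  have hspos : ∀ i, w i ≠ 0 → s i ≠ 0 := fun i hi => by
    have := hs2 i
    intro h0
    rw [h0] at this
    exact div_ne_zero (hv i).ne' hi (by simpa using this.symm)
  set C : Matrix ι ι ℝ := of fun i j => s i * A i j * s j with hCdef
  have hC : C.IsSymm := by
    ext i j; simp only [hCdef, transpose_apply, of_apply, hAs j i]; ring
  have hCmul : ∀ y i, C.mulVec y i = s i * A.mulVec (fun j => s j * y j) i := by
    intro y i
    simp only [hCdef, mulVec, dotProduct, of_apply, Finset.mul_sum]
    exact Finset.sum_congr rfl fun j _ => by ring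
  have hCquad : ∀ y : ι → ℝ,
      y ⬝ᵥ C.mulVec y = (fun j => s j * y j) ⬝ᵥ A.mulVec (fun j => s j * y j) := by
    intro y
    simp only [dotProduct, hCmul]
    exact Finset.sum_congr rfl fun j _ => by ring
  refine .of_nonpos_on_ker hAsymm w fun x hx => ?_
  set y : ι → ℝ := fun i => x i / s i with hy
  have hxy : x ⬝ᵥ A.mulVec x = y ⬝ᵥ C.mulVec y := by
    rw [hCquad]
    simp only [dotProduct, mulVec, Finset.mul_sum]
    refine Finset.sum_congr rfl fun i _ => Finset.sum_congr rfl fun j _ => ?_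
    by_cases hi : w i = 0
    · rw [hwA i hi]; simp
    by_cases hj : w j = 0
    · rw [hAs, hwA j hj]; simp
    rw [hy]
    simp only
    rw [mul_div_cancel₀ _ (hspos i hi), mul_div_cancel₀ _ (hspos j hj)]
  rw [hxy]
  refine hC.dotProduct_mulVec_nonpos y fun μ e hμ he => ?_
  set f : ι → ℝ := fun j => s j * e j with hf
  have hei : ∀ i, s i * A.mulVec f i = μ * e i := fun i => by rw [← hCmul, he]; rfl
  have he0 : ∀ i, w i = 0 → e i = 0 := by
    intro i hi
    have h1 := hei i
    have h2 : s i = 0 := by simp [hs, hi]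
    rw [h2, zero_mul] at h1
    exact (mul_eq_zero.1 h1.symm).resolve_left hμ.ne'
  have h1 : f ⬝ᵥ A.mulVec f = μ * ∑ i, e i ^ 2 := by
    rw [← hCquad, he, dotProduct_smul, smul_eq_mul]
    simp only [dotProduct, pow_two]
  have h2 : ∑ i, v i / w i * (A.mulVec f i) ^ 2 = μ ^ 2 * ∑ i, e i ^ 2 := by
    rw [Finset.mul_sum]
    refine Finset.sum_congr rfl fun i _ => ?_
    rw [← hs2, ← mul_pow, hei, mul_pow]
  have h3 : ∑ i, w i * f i ^ 2 / v i = ∑ i, e i ^ 2 := by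
    refine Finset.sum_congr rfl fun i _ => ?_
    by_cases hi : w i = 0
    · rw [hi, he0 i hi]; simp
    · rw [hf]
      simp only
      rw [mul_pow, hs2]
      have := (hv i).ne'
      field_simp
  have h4 := hbochner f
  rw [h1, h2] at h4
  have hnn : ∀ i j, 0 ≤ A i j * v i * v j * (f i / v i - f j / v j) ^ 2 := fun i j =>
    mul_nonneg (mul_nonneg (mul_nonneg (hA0 i j) (hv i).le) (hv j).le) (sq_nonneg _)
  have hsq : 0 ≤ ∑ i, e i ^ 2 := Finset.sum_nonneg fun i _ => sq_nonneg _
  -- For an eigenvector with `μ > 0`, `hbochner` gives `μ ≤ μ²` and `hlap` gives `μ ≤ 1`. Hence the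
  -- energy vanishes and `f / v` is constant along edges.
  have h5 : ∑ i, ∑ j, A i j * v i * v j * (f i / v i - f j / v j) ^ 2 = 0 := by
    refine le_antisymm ?_ (Finset.sum_nonneg fun i _ => Finset.sum_nonneg fun j _ => hnn i j)
    rw [hlap, h1, h3]
    rcases hsq.eq_or_lt with h0 | hpos
    · rw [← h0]; simp
    · have : 1 ≤ μ := by
        by_contra hlt
        push Not at hlt
        have := mul_pos (mul_pos hμ (sub_pos.2 hlt)) hpos
        nlinarith
      nlinarith
  have h6 : ∀ i j, 0 < A i j → f i / v i = f j / v j := by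
    intro i j hij
    have h7 := (Finset.sum_eq_zero_iff_of_nonneg fun i _ =>
      Finset.sum_nonneg fun j _ => hnn i j).1 h5 i (Finset.mem_univ i)
    have h8 := (Finset.sum_eq_zero_iff_of_nonneg fun j _ => hnn i j).1 h7 j (Finset.mem_univ j)
    have h9 := (mul_eq_zero.1 h8).resolve_left (mul_pos (mul_pos hij (hv i)) (hv j)).ne'
    exact sub_eq_zero.1 (pow_eq_zero_iff two_ne_zero |>.1 h9)
  by_cases hall : ∀ i, w i = 0
  · simp [dotProduct, he0 _ (hall _)]
  push Not at hall
  obtain ⟨i₀, hi₀⟩ := hall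
  have hTne : ∀ i, w i ≠ 0 → T i ≠ 0 := by
    intro i hi h0
    apply hi
    rw [hw, hAx, h0]; simp
  -- By connectivity `f` is a multiple of `v` where `w` is nonzero, so `e ⬝ᵥ y` is a multiple of `w
  -- ⬝ᵥ x = 0`.
  have h7 : ∀ i, e i * y i = f i₀ / v i₀ * (w i * x i) := by
    intro i
    by_cases hi : w i = 0
    · rw [he0 i hi, hi]; simp
    obtain ⟨k, hik, hjk⟩ := hconn i i₀ (hTne i hi) (hTne i₀ hi₀)
    have h8 : f i / v i = f i₀ / v i₀ := (h6 i k hik).trans (h6 i₀ k hjk).symm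
    rw [← h8, hy, hf]
    simp only
    have h9 := hspos i hi
    have h10 := (hv i).ne'
    have h11 : s i ^ 2 * w i = v i := by rw [hs2]; field_simp
    field_simp
    linear_combination (-(e i * x i)) * h11
  simp only [dotProduct, h7, ← Finset.mul_sum]
  simp only [dotProduct] at hx
  rw [hx, mul_zero]

end Matrix

open scoped Matroid

/-! ### Iterated directional derivatives and homogeneity -/

section Derivatives

variable {n : ℕ}

theorem dirDeriv_apply (v : Fin n → ℝ) (p : MvPolynomial (Fin n) ℝ) :
    dirDeriv v p = ∑ i, v i • pderiv i p := by
  simp [dirDeriv, LinearMap.sum_apply]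

theorem MvPolynomial.pderiv_comm {σ R : Type*} [CommSemiring R] (i j : σ) (p : MvPolynomial σ R) :
    pderiv i (pderiv j p) = pderiv j (pderiv i p) := by
  classical
  ext m
  simp only [coeff_pderiv, add_right_comm m (Finsupp.single i 1), Finsupp.add_apply,
    Finsupp.single_apply]
  rcases eq_or_ne i j with rfl | h
  · rfl
  · simp [h, h.symm]; ring

theorem dirDeriv_pderiv (v : Fin n → ℝ) (i : Fin n) (p : MvPolynomial (Fin n) ℝ) :
    dirDeriv v (pderiv i p) = pderiv i (dirDeriv v p) := by
  simp only [dirDeriv_apply, map_sum, Derivation.map_smul, pderiv_comm i]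

/-- The composition of the directional derivatives along the vectors in a list. -/
noncomputable def listDeriv (L : List (Fin n → ℝ)) : Module.End ℝ (MvPolynomial (Fin n) ℝ) :=
  (L.map dirDeriv).prod

@[simp]
theorem listDeriv_nil (p : MvPolynomial (Fin n) ℝ) : listDeriv [] p = p := rfl

theorem listDeriv_cons (v : Fin n → ℝ) (L : List (Fin n → ℝ)) (p : MvPolynomial (Fin n) ℝ) :
    listDeriv (v :: L) p = dirDeriv v (listDeriv L p) := by
  simp [listDeriv]

theorem listDeriv_append (L L' : List (Fin n → ℝ)) (p : MvPolynomial (Fin n) ℝ) :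
    listDeriv (L ++ L') p = listDeriv L (listDeriv L' p) := by
  simp [listDeriv]

theorem listDeriv_pderiv (L : List (Fin n → ℝ)) (i : Fin n) (p : MvPolynomial (Fin n) ℝ) :
    listDeriv L (pderiv i p) = pderiv i (listDeriv L p) := by
  induction L with
  | nil => rfl
  | cons v L ih => rw [listDeriv_cons, ih, dirDeriv_pderiv, listDeriv_cons]

theorem listDeriv_cons_eq_sum (v : Fin n → ℝ) (L : List (Fin n → ℝ))
    (p : MvPolynomial (Fin n) ℝ) :
    listDeriv (v :: L) p = ∑ i, v i • listDeriv L (pderiv i p) := by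
  simp only [listDeriv_cons, dirDeriv_apply, listDeriv_pderiv]

theorem matDeriv_eq_listDeriv {k : ℕ} (V : Matrix (Fin n) (Fin k) ℝ) :
    matDeriv V = listDeriv (List.ofFn fun j i => V i j) := by
  rw [matDeriv, listDeriv, List.map_ofFn]
  rfl

theorem secondDerivForm_apply (p : MvPolynomial (Fin n) ℝ) (x a b : Fin n → ℝ) :
    secondDerivForm p x a b = a ⬝ᵥ (hessianAt p x).mulVec b := by
  change eval x (dirDeriv a (dirDeriv b p)) = _
  simp only [dirDeriv_apply, map_sum, Derivation.map_smul, smul_eval, hessianAt, dotProduct,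
    Matrix.mulVec, Matrix.of_apply, Finset.mul_sum]
  rw [Finset.sum_comm]
  exact Finset.sum_congr rfl fun i _ => Finset.sum_congr rfl fun j _ => by ring

theorem hessianAt_isSymm (p : MvPolynomial (Fin n) ℝ) (x : Fin n → ℝ) :
    (hessianAt p x).IsSymm := by
  ext i j
  simp only [Matrix.transpose_apply, hessianAt, Matrix.of_apply, pderiv_comm i j]

theorem dirDeriv_isHomogeneous {p : MvPolynomial (Fin n) ℝ} {m : ℕ} (hp : p.IsHomogeneous m)
    (v : Fin n → ℝ) : (dirDeriv v p).IsHomogeneous (m - 1) := by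
  rw [dirDeriv_apply]
  refine IsHomogeneous.sum _ _ _ fun i _ => ?_
  rw [smul_eq_C_mul]
  simpa using (isHomogeneous_C (Fin n) (v i)).mul (hp.pderiv (i := i))

theorem listDeriv_isHomogeneous {p : MvPolynomial (Fin n) ℝ} {m : ℕ} (hp : p.IsHomogeneous m)
    (L : List (Fin n → ℝ)) : (listDeriv L p).IsHomogeneous (m - L.length) := by
  induction L with
  | nil => exact hp
  | cons v L ih =>
    rw [listDeriv_cons, List.length_cons, ← Nat.sub_sub]
    exact dirDeriv_isHomogeneous ih v

theorem eval_dirDeriv_self {p : MvPolynomial (Fin n) ℝ} {m : ℕ} (hp : p.IsHomogeneous m)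
    (x : Fin n → ℝ) : eval x (dirDeriv x p) = m * eval x p := by
  have := congrArg (eval x) hp.sum_X_mul_pderiv
  simpa [dirDeriv_apply, smul_eval] using this

/-- The `m`-th derivative along `x` of a homogeneous polynomial of degree `m` is the constant
`m! • p x`. -/
theorem eval_zero_listDeriv_replicate {m : ℕ} {p : MvPolynomial (Fin n) ℝ}
    (hp : p.IsHomogeneous m) (x : Fin n → ℝ) :
    eval 0 (listDeriv (List.replicate m x) p) = m.factorial * eval x p := by
  induction m generalizing p with
  | zero =>
    obtain ⟨c, rfl⟩ : ∃ c, p = C c := ⟨_, (totalDegree_eq_zero_iff_eq_C.1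
      (Nat.le_zero.1 hp.totalDegree_le))⟩
    simp
  | succ m ih =>
    rw [List.replicate_succ', listDeriv_append, ih (p := listDeriv [x] p)]
    · rw [listDeriv_cons, listDeriv_nil, eval_dirDeriv_self hp, Nat.factorial_succ]
      push_cast; ring
    · exact listDeriv_isHomogeneous hp [x]

theorem tendsto_eval_listDeriv {α κ : Type*} {l : Filter α} {x : α → Fin n → ℝ} {x₀ : Fin n → ℝ}
    (hx : Filter.Tendsto x l (nhds x₀)) {f : κ → α → Fin n → ℝ} {f₀ : κ → Fin n → ℝ}
    (hf : ∀ k, Filter.Tendsto (f k) l (nhds (f₀ k))) (L : List κ) (p : MvPolynomial (Fin n) ℝ) :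
    Filter.Tendsto (fun t => eval (x t) (listDeriv (L.map fun k => f k t) p)) l
      (nhds (eval x₀ (listDeriv (L.map f₀) p))) := by
  induction L generalizing p with
  | nil => exact ((MvPolynomial.continuous_eval p).tendsto x₀).comp hx
  | cons k L ih =>
    simp only [List.map_cons, listDeriv_cons_eq_sum, map_sum, smul_eval]
    exact tendsto_finsetSum _ fun i _ => ((tendsto_pi_nhds.1 (hf k)) i).mul (ih _)

end Derivatives

/-! ### Derivatives of the basis generating polynomial as contractions -/

namespace Matroid

variable {n : ℕ} {M : Matroid (Fin n)}

-- The sum in `basisGenPoly` unfolds to one over `Set (Fin n)`, written with the `Finset` monad;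
-- this form is easier to manipulate.
open Classical in
theorem basisGenPoly_eq_sum_finset (M : Matroid (Fin n)) :
    M.basisGenPoly = ∑ B ∈ (Finset.univ : Finset (Finset (Fin n))).filter
      (fun B : Finset (Fin n) => M.IsBase (B : Set (Fin n))), ∏ i ∈ B, X i := by
  simp only [basisGenPoly, Finset.bind_def, Finset.pure_def, Finset.sup_singleton_apply]
  symm
  refine Finset.sum_nbij (fun B => (B : Set (Fin n))) (fun B hB => ?_)
    (fun _ _ _ _ h => Finset.coe_injective h) (fun B hB => ?_) fun B _ => ?_
  · simpa using hB
  · exact ⟨B.toFinset, by simpa using (Finset.mem_filter.1 hB).2, by simp⟩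
  · simp only [Finset.toFinset_coe]

theorem IsNonloop.eRank_contract {α : Type*} {M : Matroid α} {e : α} (he : M.IsNonloop e) :
    (M ／ {e}).eRank + 1 = M.eRank := by
  obtain ⟨B, hB⟩ := (M ／ {e}).exists_isBase
  have h := he.indep.contract_isBase_iff.1 hB
  rw [← hB.encard_eq_eRank, ← h.1.encard_eq_eRank, Set.encard_union_eq h.2, Set.encard_singleton]

theorem pderiv_prod_X {σ : Type*} [DecidableEq σ] (e : σ) (B : Finset σ) :
    pderiv e (∏ i ∈ B, X i : MvPolynomial σ ℝ) = if e ∈ B then ∏ i ∈ B.erase e, X i else 0 := by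
  have h0 : ∀ B : Finset σ, e ∉ B → pderiv e (∏ i ∈ B, X i : MvPolynomial σ ℝ) = 0 := by
    intro B hB
    induction B using Finset.induction_on with
    | empty => simp
    | insert a s ha ih =>
      rw [Finset.mem_insert, not_or] at hB
      rw [Finset.prod_insert ha, pderiv_mul, ih hB.2, pderiv_X_of_ne (Ne.symm hB.1)]
      simp
  split_ifs with h
  · rw [← Finset.mul_prod_erase B _ h, pderiv_mul, h0 _ (Finset.notMem_erase e B)]
    simp
  · exact h0 B h

/-- Removing `e` matches the bases of `M` containing `e` with those of the contraction. The type
`Fin n` stays fixed and only the ground set shrinks, so inductions can generalize over `M`. -/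
theorem pderiv_basisGenPoly_of_isNonloop {e : Fin n} (he : M.IsNonloop e) :
    pderiv e M.basisGenPoly = (M ／ {e}).basisGenPoly := by
  classical
  simp only [basisGenPoly_eq_sum_finset, map_sum, pderiv_prod_X, he.indep.contract_isBase_iff]
  rw [← Finset.sum_filter]
  refine Finset.sum_bij' (fun B _ => B.erase e) (fun B _ => insert e B) ?_ ?_ ?_ ?_ ?_
  · intro B hB
    simp only [Finset.mem_filter, Finset.mem_univ, true_and] at hB ⊢
    simp [hB.1, hB.2]
  · intro B hB
    simp only [Finset.mem_filter, Finset.mem_univ, true_and] at hB ⊢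
    simpa using hB.1
  · intro B hB
    simp only [Finset.mem_filter, Finset.mem_univ, true_and] at hB
    exact Finset.insert_erase hB.2
  · intro B hB
    simp only [Finset.mem_filter, Finset.mem_univ, true_and] at hB
    exact Finset.erase_insert (by simpa using hB.2)
  · intro B _; rfl

theorem pderiv_basisGenPoly_of_not_isNonloop {e : Fin n} (he : ¬ M.IsNonloop e) :
    pderiv e M.basisGenPoly = 0 := by
  classical
  simp only [basisGenPoly_eq_sum_finset, map_sum, pderiv_prod_X]
  refine Finset.sum_eq_zero fun B hB => if_neg fun heB => he ?_
  exact (Finset.mem_filter.1 hB).2.indep.isNonloop_of_mem heB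

theorem pderiv_pderiv_basisGenPoly_of_not_isNonloop {e : Fin n} (f : Fin n)
    (he : ¬ M.IsNonloop e) : pderiv f (pderiv e M.basisGenPoly) = 0 := by
  rw [pderiv_basisGenPoly_of_not_isNonloop he, map_zero]

theorem basisGenPoly_isHomogeneous {r : ℕ} (hr : M.eRank = r) :
    M.basisGenPoly.IsHomogeneous r := by
  classical
  rw [basisGenPoly_eq_sum_finset]
  refine IsHomogeneous.sum _ _ _ fun B hB => ?_
  have hB := (Finset.mem_filter.1 hB).2.encard_eq_eRank
  rw [hr, Set.encard_coe_eq_coe_finsetCard] at hB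
  have := IsHomogeneous.prod B (fun i => (X i : MvPolynomial (Fin n) ℝ)) (fun _ => 1)
    fun i _ => isHomogeneous_X ℝ i
  simpa [Nat.cast_inj.1 hB] using this

theorem basisGenPoly_of_eRank_eq_zero (hr : M.eRank = 0) : M.basisGenPoly = 1 := by
  classical
  have h : ∀ B : Finset (Fin n), M.IsBase (B : Set (Fin n)) ↔ B = ∅ := by
    intro B
    have h1 : ∀ B : Set (Fin n), M.IsBase B → B = ∅ := fun B hB => by
      have := hB.encard_eq_eRank
      rwa [hr, Set.encard_eq_zero] at this
    refine ⟨fun hB => by simpa using h1 _ hB, ?_⟩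
    rintro rfl
    obtain ⟨B, hB⟩ := M.exists_isBase
    rw [h1 B hB] at hB
    simpa using hB
  simp [basisGenPoly_eq_sum_finset, h, Finset.filter_eq']

theorem eval_listDeriv_basisGenPoly_nonneg (M : Matroid (Fin n)) {L : List (Fin n → ℝ)}
    (hL : ∀ v ∈ L, ∀ i, 0 ≤ v i) {x : Fin n → ℝ} (hx : ∀ i, 0 ≤ x i) :
    0 ≤ eval x (listDeriv L M.basisGenPoly) := by
  induction L generalizing M with
  | nil =>
    rw [listDeriv_nil, basisGenPoly, map_sum]
    refine Finset.sum_nonneg fun B _ => ?_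
    rw [map_prod]
    exact Finset.prod_nonneg fun i _ => by simpa using hx i
  | cons v L ih =>
    rw [listDeriv_cons_eq_sum, map_sum]
    refine Finset.sum_nonneg fun i _ => ?_
    rw [smul_eval]
    refine mul_nonneg (hL v (by simp) i) ?_
    by_cases hi : M.IsNonloop i
    · rw [pderiv_basisGenPoly_of_isNonloop hi]
      exact ih _ fun v hv => hL v (by simp [hv])
    · rw [pderiv_basisGenPoly_of_not_isNonloop hi]; simp

theorem eval_listDeriv_pderiv_basisGenPoly_nonneg (M : Matroid (Fin n)) {L : List (Fin n → ℝ)}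
    (hL : ∀ v ∈ L, ∀ i, 0 ≤ v i) {x : Fin n → ℝ} (hx : ∀ i, 0 ≤ x i) (i j : Fin n) :
    0 ≤ eval x (listDeriv L (pderiv i (pderiv j M.basisGenPoly))) := by
  have h1 : ∀ k : Fin n, dirDeriv (Pi.single k 1) = (pderiv k).toLinearMap := fun k => by
    ext1 p
    simp [dirDeriv, Pi.single_apply]
  have := M.eval_listDeriv_basisGenPoly_nonneg (L := L ++ [Pi.single i 1, Pi.single j 1])
    (x := x) (fun v hv k => by
      simp only [List.mem_append, List.mem_cons, List.not_mem_nil, or_false] at hv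
      rcases hv with hv | rfl | rfl
      · exact hL v hv k
      · rw [Pi.single_apply]; positivity
      · rw [Pi.single_apply]; positivity) hx
  simpa [listDeriv_append, listDeriv_cons, h1] using this

/-- Each derivative contracts a nonloop, which exists while the rank is positive; after rank-many
steps the polynomial is 1. -/
theorem eval_listDeriv_basisGenPoly_pos {L : List (Fin n → ℝ)} (hL : ∀ v ∈ L, ∀ i, 0 < v i)
    (hr : M.eRank = L.length) : 0 < eval 0 (listDeriv L M.basisGenPoly) := by
  induction L generalizing M with
  | nil => rw [basisGenPoly_of_eRank_eq_zero (by simpa using hr)]; simp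
  | cons v L ih =>
    rw [listDeriv_cons_eq_sum, map_sum]
    have hL' : ∀ v ∈ L, ∀ i, 0 < v i := fun v hv => hL v (by simp [hv])
    have hpos : ∀ i, M.IsNonloop i → 0 < eval 0 (v i • listDeriv L (pderiv i M.basisGenPoly)) := by
      intro i hi
      rw [smul_eval, pderiv_basisGenPoly_of_isNonloop hi]
      refine mul_pos (hL v (by simp) i) (ih hL' ?_)
      have := hi.eRank_contract
      rw [hr, List.length_cons, Nat.cast_succ] at this
      exact (ENat.add_left_injective_of_ne_top ENat.one_ne_top) this
    have : M.RankPos := by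
      obtain ⟨B, hB⟩ := M.exists_isBase
      refine hB.rankPos_of_nonempty (Set.nonempty_iff_ne_empty.2 ?_)
      rintro rfl
      have := hB.encard_eq_eRank
      rw [hr] at this
      rw [Set.encard_empty] at this
      norm_cast at this
    obtain ⟨i, hi⟩ := M.exists_isNonloop
    refine Finset.sum_pos' (fun j _ => ?_) ⟨i, Finset.mem_univ i, hpos i hi⟩
    by_cases hj : M.IsNonloop j
    · exact (hpos j hj).le
    · rw [pderiv_basisGenPoly_of_not_isNonloop hj]; simp

end Matroid

/-- The double sum is a sum of squares, one for each fibre of `c`; the fibres will be parallel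
classes. -/
theorem Finset.sum_sum_ite_eq_nonneg {ι κ : Type*} [Fintype ι] [Fintype κ] [DecidableEq κ]
    (c : ι → κ) (y : ι → ℝ) : 0 ≤ ∑ i, ∑ j, if c i = c j then y i * y j else 0 := by
  have h : ∑ i, ∑ j, (if c i = c j then y i * y j else 0) =
      ∑ k, (∑ i, if c i = k then y i else 0) ^ 2 := by
    symm
    simp only [pow_two, Finset.sum_mul_sum]
    rw [Finset.sum_comm]
    refine Finset.sum_congr rfl fun i _ => ?_
    rw [Finset.sum_comm]
    refine Finset.sum_congr rfl fun j _ => ?_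
    simp [eq_comm]
  rw [h]
  exact Finset.sum_nonneg fun k _ => sq_nonneg _

/-! ### Rank two, induction on the rank, and limits -/

namespace Matroid

variable {n : ℕ} {M : Matroid (Fin n)}

theorem pderiv_pderiv_basisGenPoly_of_notMem_closure {i j : Fin n} (hi : M.IsNonloop i)
    (hj : M.IsNonloop j) (hij : i ∉ M.closure {j}) :
    pderiv i (pderiv j M.basisGenPoly) = (M ／ {j} ／ {i}).basisGenPoly ∧
      (M ／ {j} ／ {i}).eRank + 2 = M.eRank := by
  have hi' : (M ／ {j}).IsNonloop i := contract_isNonloop_iff.2 ⟨hi.mem_ground, hij⟩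
  rw [pderiv_basisGenPoly_of_isNonloop hj, pderiv_basisGenPoly_of_isNonloop hi',
    ← hj.eRank_contract, ← hi'.eRank_contract, add_assoc, one_add_one_eq_two]
  exact ⟨rfl, rfl⟩

theorem pderiv_pderiv_basisGenPoly_of_mem_closure {i j : Fin n} (hij : i ∈ M.closure {j}) :
    pderiv i (pderiv j M.basisGenPoly) = 0 := by
  by_cases hj : M.IsNonloop j
  · rw [pderiv_basisGenPoly_of_isNonloop hj, pderiv_basisGenPoly_of_not_isNonloop]
    rw [contract_isNonloop_iff]
    exact fun h => h.2 hij
  · exact pderiv_pderiv_basisGenPoly_of_not_isNonloop i hj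

-- In rank 2 a pair is a base exactly when it consists of nonloops from different parallel classes,
-- and a class is recorded by its closure.
open Classical in
theorem eval_pderiv_pderiv_basisGenPoly_of_eRank_eq_two (hr : M.eRank = 2) (i j : Fin n)
    (x : Fin n → ℝ) :
    eval x (pderiv i (pderiv j M.basisGenPoly)) =
      (if M.IsNonloop i then 1 else 0) * (if M.IsNonloop j then 1 else 0) *
        (1 - if M.closure {i} = M.closure {j} then 1 else 0) := by
  by_cases hj : M.IsNonloop j
  swap
  · rw [pderiv_pderiv_basisGenPoly_of_not_isNonloop i hj]; simp [hj]
  by_cases hi : M.IsNonloop i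
  swap
  · rw [pderiv_comm, pderiv_pderiv_basisGenPoly_of_not_isNonloop j hi]; simp [hi]
  by_cases hij : i ∈ M.closure {j}
  · rw [pderiv_pderiv_basisGenPoly_of_mem_closure hij]
    simp [hi.closure_eq_of_mem_closure hij]
  · obtain ⟨h1, h2⟩ := pderiv_pderiv_basisGenPoly_of_notMem_closure hi hj hij
    have hne : M.closure {i} ≠ M.closure {j} := fun h =>
      hij (h ▸ M.mem_closure_self i hi.mem_ground)
    have h0 : (M ／ {j} ／ {i}).eRank = 0 := by
      rw [hr] at h2
      exact ENat.add_left_injective_of_ne_top (n := 2) (by simp) (by simpa using h2)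
    rw [h1, basisGenPoly_of_eRank_eq_zero h0]
    simp [hi, hj, hne]

theorem reversedCauchySchwarz_of_eRank_eq_two (hr : M.eRank = 2) (x : Fin n → ℝ) :
    (hessianAt M.basisGenPoly x).ReversedCauchySchwarz := by
  classical
  refine .of_nonpos_on_ker (hessianAt_isSymm _ _) (fun i => if M.IsNonloop i then 1 else 0)
    fun a ha => ?_
  set y : Fin n → ℝ := fun i => (if M.IsNonloop i then 1 else 0) * a i with hy
  have h1 : a ⬝ᵥ (hessianAt M.basisGenPoly x).mulVec a = (∑ i, y i) * (∑ j, y j) -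
      ∑ i, ∑ j, if M.closure {i} = M.closure {j} then y i * y j else 0 := by
    rw [Finset.sum_mul_sum, ← Finset.sum_sub_distrib]
    simp only [dotProduct, Matrix.mulVec, hessianAt, Matrix.of_apply, ← Finset.sum_sub_distrib, eval_pderiv_pderiv_basisGenPoly_of_eRank_eq_two hr,
      Finset.mul_sum]
    refine Finset.sum_congr rfl fun i _ => Finset.sum_congr rfl fun j _ => ?_
    simp only [hy]
    split_ifs <;> ring
  have h2 : ∑ i, y i = 0 := ha
  rw [h1, h2]
  have := Finset.sum_sum_ite_eq_nonneg (fun i => M.closure {i}) y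
  linarith

/-- In a matroid of rank at least three, any two nonloops have a common neighbour in the graph of
independent pairs. -/
theorem exists_notMem_closure_of_three_le_eRank {α : Type*} {M : Matroid α} (hr : 3 ≤ M.eRank)
    {i j : α} (hi : M.IsNonloop i) (hj : M.IsNonloop j) :
    ∃ k, M.IsNonloop k ∧ i ∉ M.closure {k} ∧ j ∉ M.closure {k} := by
  obtain ⟨k, hk, hkc⟩ : ∃ k ∈ M.E, k ∉ M.closure {i, j} := by
    by_contra! h
    have h1 : M.eRk M.E ≤ M.eRk (M.closure {i, j}) := M.eRk_mono h
    rw [eRk_closure_eq, eRk_ground] at h1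
    have h2 := (hr.trans h1).trans ((M.eRk_le_encard _).trans (Set.encard_insert_le {j} i))
    rw [Set.encard_singleton] at h2
    norm_num at h2
  have hki : k ∉ M.closure {i} := fun h => hkc (M.closure_subset_closure (by simp) h)
  have hkj : k ∉ M.closure {j} := fun h => hkc (M.closure_subset_closure (by simp) h)
  have hk' : M.IsNonloop k := (M.isNonloop_iff_notMem_loops hk).2 fun h =>
    hki (M.closure_subset_closure (Set.empty_subset _) h)
  exact ⟨k, hk', fun h => hki (hi.mem_closure_singleton h),
    fun h => hkj (hj.mem_closure_singleton h)⟩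

/-- Derivatives of the basis generating polynomial of a matroid down to degree two along positive
directions have a Lorentzian Hessian. -/
theorem reversedCauchySchwarz_hessianAt_listDeriv_zero {L : List (Fin n → ℝ)}
    (hL : ∀ v ∈ L, ∀ i, 0 < v i) (hr : M.eRank = L.length + 2) :
    (hessianAt (listDeriv L M.basisGenPoly) 0).ReversedCauchySchwarz := by
  induction L generalizing M with
  | nil => exact reversedCauchySchwarz_of_eRank_eq_two (by simpa using hr) 0
  | cons v L ih =>
    have hL' : ∀ v ∈ L, ∀ i, 0 < v i := fun v hv => hL v (by simp [hv])
    have hT : ∀ l i j, hessianAt (listDeriv L (pderiv l M.basisGenPoly)) 0 i j =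
        eval 0 (listDeriv L (pderiv i (pderiv j (pderiv l M.basisGenPoly)))) := fun l i j => by
      simp only [hessianAt, Matrix.of_apply, listDeriv_pderiv]
    have hr' : ∀ l, M.IsNonloop l → (M ／ {l}).eRank = L.length + 2 := by
      intro l hl
      have := hl.eRank_contract
      rw [hr, List.length_cons, Nat.cast_succ, add_right_comm] at this
      exact ENat.add_left_injective_of_ne_top ENat.one_ne_top this
    have hne : ∀ l, hessianAt (listDeriv L (pderiv l M.basisGenPoly)) 0 ≠ 0 → M.IsNonloop l := by
      intro l h
      by_contra hl
      apply h
      rw [pderiv_basisGenPoly_of_not_isNonloop hl]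
      ext i j
      simp [hessianAt]
    -- Slice `l` comes from `M ／ {l}`, or vanishes if `l` is not a nonloop; tensor symmetry is the
    -- commutation of third derivatives.
    refine .of_slices (T := fun l => hessianAt (listDeriv L (pderiv l M.basisGenPoly)) 0) (v := v)
      ?_ (hL v (by simp)) ?_ ?_ ?_ ?_ ?_
    · intro i j
      simp only [hT]
      simp only [hessianAt, Matrix.of_apply, listDeriv_cons_eq_sum, map_sum, Derivation.map_smul,
        smul_eval, listDeriv_pderiv]
    · intro l i j
      by_cases hl : M.IsNonloop l
      · rw [hT, pderiv_basisGenPoly_of_isNonloop hl]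
        exact eval_listDeriv_pderiv_basisGenPoly_nonneg _ (fun v hv i => (hL' v hv i).le) (x := 0)
          (fun _ => le_rfl) i j
      · rw [hT, pderiv_basisGenPoly_of_not_isNonloop hl]; simp
    · intro l i j
      rw [hT, hT, pderiv_comm i j]
    · intro l i j
      rw [hT, hT, pderiv_comm j l, pderiv_comm i l, pderiv_comm i j]
    · intro l
      by_cases hl : M.IsNonloop l
      · simp only [pderiv_basisGenPoly_of_isNonloop hl]
        exact ih hL' (hr' l hl)
      · by_contra h
        exact hl (hne l fun h0 => h (by
          simp only [h0]; exact Matrix.reversedCauchySchwarz_zero))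
    · have hpos : ∀ i k, M.IsNonloop i → M.IsNonloop k → i ∉ M.closure {k} →
          0 < hessianAt (listDeriv (v :: L) M.basisGenPoly) 0 i k := by
        intro i k hi hk hik
        obtain ⟨h1, h2⟩ := pderiv_pderiv_basisGenPoly_of_notMem_closure hi hk hik
        simp only [hessianAt, Matrix.of_apply, ← listDeriv_pderiv, h1]
        refine eval_listDeriv_basisGenPoly_pos hL ?_
        exact ENat.add_left_injective_of_ne_top (n := 2) (by simp) (h2.trans hr)
      intro i j hi hj
      have hr3 : 3 ≤ M.eRank := by
        rw [hr, List.length_cons]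
        exact_mod_cast Nat.le_add_left 3 L.length
      obtain ⟨k, hk, hik, hjk⟩ := exists_notMem_closure_of_three_le_eRank hr3 (hne i hi) (hne j hj)
      exact ⟨k, hpos i k (hne i hi) hk hik, hpos j k (hne j hj) hk hjk⟩

/-- With `m = r - 2 - L.length`, the Hessian entries are homogeneous of degree `m`, so `m` further
derivatives along `x` turn them into `m!` times their values at `x`. -/
theorem reversedCauchySchwarz_hessianAt_of_pos {L : List (Fin n → ℝ)}
    (hL : ∀ v ∈ L, ∀ i, 0 < v i) {x : Fin n → ℝ} (hx : ∀ i, 0 < x i) {r : ℕ} (hr : M.eRank = r)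
    (hLr : L.length + 2 ≤ r) :
    (hessianAt (listDeriv L M.basisGenPoly) x).ReversedCauchySchwarz := by
  obtain ⟨m, rfl⟩ := Nat.exists_eq_add_of_le hLr
  have h := reversedCauchySchwarz_hessianAt_listDeriv_zero (M := M)
    (L := List.replicate m x ++ L)
    (fun v hv i => by
      rcases List.mem_append.1 hv with hv | hv
      · rw [List.eq_of_mem_replicate hv]; exact hx i
      · exact hL v hv i)
    (by
      rw [hr, List.length_append, List.length_replicate]
      push_cast; ring)
  refine .of_smul (c := (m.factorial : ℝ)) (by positivity) ?_
  convert! h using 1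
  ext i j
  have hhom : (pderiv i (pderiv j (listDeriv L M.basisGenPoly))).IsHomogeneous m := by
    have := ((listDeriv_isHomogeneous (basisGenPoly_isHomogeneous hr) L).pderiv (i := j)).pderiv
      (i := i)
    convert this using 1
    omega
  simp only [hessianAt, Matrix.smul_apply, Matrix.of_apply, smul_eq_mul, listDeriv_append,
    ← listDeriv_pderiv (List.replicate m x)]
  exact (eval_zero_listDeriv_replicate hhom x).symm

/-- Basis generating polynomials of matroids are completely log-concave, in the form of a reversed
Cauchy–Schwarz inequality. -/
theorem reversedCauchySchwarz_hessianAt {k r : ℕ} (hr : M.eRank = r) (hk : k + 2 ≤ r)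
    {V : Matrix (Fin n) (Fin k) ℝ} (hV : ∀ i j, 0 ≤ V i j) {x : Fin n → ℝ} (hx : ∀ i, 0 ≤ x i) :
    (hessianAt (matDeriv V M.basisGenPoly) x).ReversedCauchySchwarz := by
  have ht : Filter.Tendsto (fun t : ℝ => t) (nhdsWithin 0 (Set.Ioi 0)) (nhds 0) :=
    Filter.tendsto_id.mono_left nhdsWithin_le_nhds
  have hadd : ∀ y : Fin n → ℝ, Filter.Tendsto (fun (t : ℝ) i => y i + t)
      (nhdsWithin 0 (Set.Ioi 0)) (nhds y) := by
    intro y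
    refine tendsto_pi_nhds.2 fun i => ?_
    simpa using (tendsto_const_nhds (x := y i)).add ht
  have hlist : ∀ t : ℝ, (List.finRange k).map (fun j i => V i j + t) =
      List.ofFn fun j i => V i j + t := fun t => by rw [List.ofFn_eq_map]
  -- All entries of `V` and `x` are shifted by `t > 0`, and `t` tends to 0.
  refine .of_tendsto (l := nhdsWithin 0 (Set.Ioi 0))
    (A := fun t : ℝ => hessianAt (listDeriv ((List.finRange k).map fun j i => V i j + t)
      M.basisGenPoly) fun i => x i + t) (fun i j => ?_) ?_
  · simp only [hessianAt, Matrix.of_apply, ← listDeriv_pderiv, matDeriv_eq_listDeriv,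
      List.ofFn_eq_map]
    exact tendsto_eval_listDeriv (hadd x) (fun j => hadd fun i => V i j) _ _
  · filter_upwards [self_mem_nhdsWithin] with t ht
    have ht : 0 < t := ht
    refine reversedCauchySchwarz_hessianAt_of_pos (fun v hv i => ?_)
      (fun i => add_pos_of_nonneg_of_pos (hx i) ht) hr (by simpa using hk)
    obtain ⟨j, -, rfl⟩ := List.mem_map.1 hv
    exact add_pos_of_nonneg_of_pos (hV i j) ht

theorem hessianAt_matDeriv_basisGenPoly_nonneg (M : Matroid (Fin n)) {k : ℕ}
    {V : Matrix (Fin n) (Fin k) ℝ} (hV : ∀ i j, 0 ≤ V i j) {x : Fin n → ℝ} (hx : ∀ i, 0 ≤ x i)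
    (i j : Fin n) : 0 ≤ hessianAt (matDeriv V M.basisGenPoly) x i j := by
  simp only [hessianAt, Matrix.of_apply, ← listDeriv_pderiv, matDeriv_eq_listDeriv]
  refine eval_listDeriv_pderiv_basisGenPoly_nonneg M (fun v hv l => ?_) hx i j
  obtain ⟨m, rfl⟩ := (List.mem_ofFn' _ _).1 hv
  exact hV l m

end Matroid

/-! ### From reversed Cauchy–Schwarz to the kernel statement -/

namespace Matrix

variable {ι : Type*} [Fintype ι] {A : Matrix ι ι ℝ}

/-- For a symmetric matrix with the reversed Cauchy–Schwarz inequality, the orthogonal complement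
of a vector outside the radical is negative semidefinite, provided that the form is nonnegative at
that vector. -/
theorem ReversedCauchySchwarz.nonpos_of_orthogonal (h : A.ReversedCauchySchwarz) (hA : A.IsSymm)
    {x a c : ι → ℝ} (hx : 0 ≤ x ⬝ᵥ A.mulVec x) (hc : x ⬝ᵥ A.mulVec c ≠ 0)
    (ha : x ⬝ᵥ A.mulVec a = 0) : a ⬝ᵥ A.mulVec a ≤ 0 := by
  by_contra! hpos
  -- A positive value at `a` makes the form nonpositive on the `A`-orthogonal complement of `a`, so
  -- `x` is isotropic.
  have hneg : ∀ b, a ⬝ᵥ A.mulVec b = 0 → b ⬝ᵥ A.mulVec b ≤ 0 := by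
    intro b hb
    have := h a b hpos
    rw [hb] at this
    exact nonpos_of_mul_nonpos_right (this.trans_eq (by norm_num)) hpos
  have hax : a ⬝ᵥ A.mulVec x = 0 := by rw [hA.dotProduct_mulVec_comm, ha]
  have hxx : x ⬝ᵥ A.mulVec x = 0 := le_antisymm (hneg x hax) hx
  set p := a ⬝ᵥ A.mulVec a
  set b : ι → ℝ := p • c - (a ⬝ᵥ A.mulVec c) • a with hb
  have hab : a ⬝ᵥ A.mulVec b = 0 := by
    simp only [hb, mulVec_sub, mulVec_smul, dotProduct_sub, dotProduct_smul, smul_eq_mul]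
    change p * _ - _ * p = 0
    ring
  have hxb : x ⬝ᵥ A.mulVec b ≠ 0 := by
    simp only [hb, mulVec_sub, mulVec_smul, dotProduct_sub, dotProduct_smul, smul_eq_mul, ha,
      mul_zero, sub_zero]
    exact mul_ne_zero hpos.ne' hc
  set q := b ⬝ᵥ A.mulVec b
  set m := x ⬝ᵥ A.mulVec b
  -- As `x` is isotropic, the form is affine in the coefficient of `x`; this coefficient makes its
  -- value 1, a contradiction.
  have := hneg (((1 - q) / (2 * m)) • x + b) (by
    simp only [mulVec_add, mulVec_smul, dotProduct_add, dotProduct_smul, hax, hab, smul_zero,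
      add_zero])
  simp only [mulVec_add, mulVec_smul, dotProduct_add, add_dotProduct, dotProduct_smul,
    smul_dotProduct, smul_eq_mul, hxx, hA.dotProduct_mulVec_comm b x, mul_zero, zero_add] at this
  change (1 - q) / (2 * m) * m + ((1 - q) / (2 * m) * m + q) ≤ 0 at this
  have h2 : (1 - q) / (2 * m) * m = (1 - q) / 2 := by field_simp
  rw [h2] at this
  linarith

theorem eq_zero_of_pos_of_dotProduct_mulVec_eq_zero (hA : ∀ i j, 0 ≤ A i j) {x : ι → ℝ}
    (hx : ∀ i, 0 < x i) (h : x ⬝ᵥ A.mulVec x = 0) : A = 0 := by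
  have h1 : ∀ i j, 0 ≤ A i j * x j := fun i j => mul_nonneg (hA i j) (hx j).le
  have h2 : ∀ i, 0 ≤ x i * A.mulVec x i := fun i =>
    mul_nonneg (hx i).le (Finset.sum_nonneg fun j _ => h1 i j)
  ext i j
  have h3 := (Finset.sum_eq_zero_iff_of_nonneg fun i _ => h2 i).1 h i (Finset.mem_univ i)
  have h4 := (mul_eq_zero.1 h3).resolve_left (hx i).ne'
  have h5 := (Finset.sum_eq_zero_iff_of_nonneg fun j _ => h1 i j).1 h4 j (Finset.mem_univ j)
  exact (mul_eq_zero.1 h5).resolve_right (hx j).ne'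

end Matrix

theorem mainTheorem7 (n r k : ℕ) (M : Matroid (Fin n)) (hE : M.E = Set.univ)
    (hsimple : M.IsSimple) (hrank : M.eRank = r) (hk : k + 2 ≤ r)
    (V : Matrix (Fin n) (Fin k) ℝ) (hV : ∀ i j, 0 ≤ V i j)
    (lam : Fin n → ℝ) (hlam : ∀ i, 0 ≤ lam i) :
    (secondDerivForm (matDeriv V M.basisGenPoly) lam).IsSymm ∧
    (((∀ i, 0 < lam i) ∨ secondDerivForm (matDeriv V M.basisGenPoly) lam lam ≠ 0) →
      ∀ a ∈ LinearMap.ker (secondDerivForm (matDeriv V M.basisGenPoly) lam lam),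
        secondDerivForm (matDeriv V M.basisGenPoly) lam a a ≤ 0) ∧
    IsSymmWithAtMostOnePosEigenvalue (hessianAt (matDeriv V M.basisGenPoly) lam) := by
  set A := hessianAt (matDeriv V M.basisGenPoly) lam with hAdef
  have hA : A.IsSymm := hessianAt_isSymm _ _
  have hRCS : A.ReversedCauchySchwarz := M.reversedCauchySchwarz_hessianAt hrank hk hV hlam
  have hnonneg : ∀ i j, 0 ≤ A i j := M.hessianAt_matDeriv_basisGenPoly_nonneg hV hlam
  have hH : A.IsHermitian := by
    rw [Matrix.IsHermitian, Matrix.conjTranspose_eq_transpose_of_trivial, hA.eq]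
  refine ⟨⟨fun a b => ?_⟩, fun h a ha => ?_, hH, hRCS.ncard_pos_eigenvalues_le_one hH⟩
  · rw [secondDerivForm_apply, secondDerivForm_apply, hA.dotProduct_mulVec_comm]
  · rw [LinearMap.mem_ker, secondDerivForm_apply] at ha
    rw [secondDerivForm_apply]
    -- If the functional vanishes, `lam` is positive, and nonnegative entries force the whole
    -- Hessian to vanish.
    by_cases hne : secondDerivForm (matDeriv V M.basisGenPoly) lam lam = 0
    · have hpos := h.resolve_right (not_not.2 hne)
      have h0 : A = 0 := Matrix.eq_zero_of_pos_of_dotProduct_mulVec_eq_zero hnonneg hpos (by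
        rw [← secondDerivForm_apply, hne, LinearMap.zero_apply])
      rw [← hAdef, h0]
      simp
    · obtain ⟨c, hc⟩ : ∃ c, secondDerivForm (matDeriv V M.basisGenPoly) lam lam c ≠ 0 := by
        by_contra! h0
        exact hne (LinearMap.ext h0)
      rw [secondDerivForm_apply] at hc
      refine hRCS.nonpos_of_orthogonal hA ?_ hc ha
      exact Finset.sum_nonneg fun i _ => mul_nonneg (hlam i) <| by
        change 0 ≤ ∑ j, A i j * lam j
        exact Finset.sum_nonneg fun j _ => mul_nonneg (hnonneg i j) (hlam j)
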